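/- **Composition rings.** Let $\mathbb H_{\mathbb Z}=M_2(\mathbb Z)$, with norm $n=\det$, trace $t$ the matrix trace, and conjugation $\overline{\begin{pmatrix}a&b\\c&d\end{pmatrix}}=\begin{pmatrix}d&-b\\-c&a\end{pmatrix}$. Let $\mathbb B_{\mathbb Z}\subset\mathbb H_{\mathbb Z}$ be the diagonal matrices, with the induced operations. Let $\mathbb O_{\mathbb Z}=\mathbb H_{\mathbb Z}\oplus\mathbb H_{\mathbb Z}v$ with $(a+bv)(c+dv)=(ac-\bar d b)+(da+b\bar c)v$, $n(a+bv)=\det a+\det b$, $t(a+bv)=t(a)$ and $\overline{a+bv}=\bar a-bv$. **Lattices.** For $C_{\mathbb Z}\in\{\mathbb B_{\mathbb Z},\mathbb H_{\mathbb Z},\mathbb O_{\mathbb Z}\}$ let $H_3(C_{\mathbb Z})$ be the $\mathbb Z$-module of Hermitian matrices $$A=\begin{pmatrix}a&z&\bar y\\ \bar z&b&x\\ y&\bar x&c\end{pmatrix},\qquad a,b,c\in\mathbb Z,\ x,y,z\in C_{\mathbb Z},$$ with the cubic form $N(A)=abc-a\,n(x)-b\,n(y)-c\,n(z)+t((xy)z)$,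 the trace bilinear form $(A,A')=aa'+bb'+cc'+t(x\overline{x'})+t(y\overline{y'})+t(z\overline{z'})$, and the quadratic adjoint $A^\#\in H_3(C_{\mathbb Z})$ whose diagonal entries are $bc-n(x)$, $ac-n(y)$, $ab-n(z)$ and whose off-diagonal parameters (in the places of $x,y,z$) are $\bar z\bar y-ax$, $\bar x\bar z-by$, $\bar y\bar x-cz$. On $\mathbb Z\oplus\mathbb Z\oplus\mathbb Z$ put $N(a,b,c)=abc$, $(a,b,c)^\#=(bc,ac,ab)$, and let $(\cdot,\cdot)$ be the standard dot product; here every element is considered diagonal. Write $X\times Y=(X+Y)^\#-X^\#-Y^\#$. **Transformations.** Let $J_{\mathbb Z}$ be one of $H_3(\mathbb B_{\mathbb Z})$, $H_3(\mathbb H_{\mathbb Z})$, $H_3(\mathbb O_{\mathbb Z})$, $\mathbb Z\oplus\mathbb Z\oplus\mathbb Z$, and let $\mathcal M(J_{\mathbb Z})=\mathbb Z\oplus\mathbb Z\oplus J_{\mathbb Z}\oplus J_{\mathbb Z}$, with elements written $(\alpha,\beta,A,B)$. For $C,D\in J_{\mathbb Z}$ and for an invertible $\mathbb Z$-linear map $s:J_{\mathbb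 Z}\to J_{\mathbb Z}$ with $N(s(X))=N(X)$ for all $X$, whose adjoint with respect to $(\cdot,\cdot)$ is $s^*$, define the elementary transformations of $\mathcal M(J_{\mathbb Z})$: $$\phi(C):(\alpha,\beta,A,B)\mapsto(\alpha+(B,C)+(A,C^\#)+\beta N(C),\ \beta,\ A+\beta C,\ B+A\times C+\beta C^\#),$$ $$\psi(D):(\alpha,\beta,A,B)\mapsto(\alpha,\ \beta+(A,D)+(B,D^\#)+\alpha N(D),\ A+B\times D+\alpha D^\#,\ B+\alpha D),$$ $$T(s):(\alpha,\beta,A,B)\mapsto(\alpha,\beta,s(A),(s^*)^{-1}(B)),\qquad \tau:(\alpha,\beta,A,B)\mapsto(-\beta,\alpha,-B,A).$$ **Lemma.** Every nonzero element of $\mathcal M(J_{\mathbb Z})$ can be carried by a finite sequence of transformations of the form $\phi(C)$, $\psi(D)$, $T(s)$, $\tau$ to a diagonal reduced element, that is, to an element $(\alpha,\beta,A,0)$ with $\alpha>0$, $\alpha\mid\beta$, $\alpha\mid A$ (i.e. $A=\alpha A'$ for some $A'\in J_{\mathbb Z}$), and $A$ diagonal. -/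

import Mathlib

/-! ## Composition rings over `ℤ`: split binarions, quaternions and octonions -/

/-- A (not necessarily associative) unital ring with a conjugation, an integer-valued norm
permitting composition, and an integer-valued trace. -/
class CompositionRing (C : Type) [NonAssocRing C] where
  conj : C → C
  nrm : C → ℤ
  tr : C → ℤ
  conj_add : ∀ x y, conj (x + y) = conj x + conj y
  conj_mul : ∀ x y, conj (x * y) = conj y * conj x
  conj_conj : ∀ x, conj (conj x) = x
  mul_conj : ∀ x, x * conj x = nrm x • (1 : C)
  add_conj : ∀ x, x + conj x = tr x • (1 : C)
  nrm_mul : ∀ x y, nrm (x * y) = nrm x * nrm y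

/-- Integral split binarions: the pair `(a, d)` is the diagonal matrix `diag(a, d)`,
with entrywise operations. -/
abbrev Binarion : Type := ℤ × ℤ

instance : CompositionRing Binarion where
  conj p := (p.2, p.1)
  nrm p := p.1 * p.2
  tr p := p.1 + p.2
  conj_add _ _ := rfl
  conj_mul x y := by ext <;> simp [mul_comm]
  conj_conj _ := rfl
  mul_conj x := by ext <;> simp [mul_comm]
  add_conj x := by ext <;> simp [add_comm]
  nrm_mul x y := by simp; ring

/-- Integral split quaternions: integral `2 × 2` matrices, with the determinant as norm, the
matrix trace, and the symplectic involution `[a, b; c, d] ↦ [d, -b; -c, a]` as conjugation. -/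
abbrev Quat : Type := Matrix (Fin 2) (Fin 2) ℤ

instance : CompositionRing Quat where
  conj M := M.adjugate
  nrm M := M.det
  tr M := M.trace
  conj_add x y := by
    ext i j; fin_cases i <;> fin_cases j <;> simp [Matrix.adjugate_fin_two, add_comm]
  conj_mul x y := Matrix.adjugate_mul_distrib x y
  conj_conj x := by
    ext i j; fin_cases i <;> fin_cases j <;> simp [Matrix.adjugate_fin_two]
  mul_conj x := by
    exact Matrix.mul_adjugate x
  add_conj x := by
    ext i j; fin_cases i <;> fin_cases j <;>
      simp [Matrix.adjugate_fin_two, Matrix.trace, Fin.sum_univ_two, add_comm]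
  nrm_mul x y := Matrix.det_mul x y

/-- Integral split octonions `re + im v` with `re`, `im` integral split quaternions. -/
@[ext]
structure Oct : Type where
  re : Quat
  im : Quat

namespace Oct

instance : Zero Oct := ⟨⟨0, 0⟩⟩
instance : One Oct := ⟨⟨1, 0⟩⟩
instance : Add Oct := ⟨fun x y => ⟨x.re + y.re, x.im + y.im⟩⟩
instance : Neg Oct := ⟨fun x => ⟨-x.re, -x.im⟩⟩
instance : Sub Oct := ⟨fun x y => ⟨x.re - y.re, x.im - y.im⟩⟩
instance : SMul ℕ Oct := ⟨fun n x => ⟨n • x.re, n • x.im⟩⟩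
instance : SMul ℤ Oct := ⟨fun n x => ⟨n • x.re, n • x.im⟩⟩
/-- `(a + b v)(c + d v) = (a c - d̄ b) + (d a + b c̄) v`. -/
instance : Mul Oct :=
  ⟨fun x y => ⟨x.re * y.re - y.im.adjugate * x.im, y.im * x.re + x.im * y.re.adjugate⟩⟩

@[simp] theorem zero_re : (0 : Oct).re = 0 := rfl
@[simp] theorem zero_im : (0 : Oct).im = 0 := rfl
@[simp] theorem one_re : (1 : Oct).re = 1 := rfl
@[simp] theorem one_im : (1 : Oct).im = 0 := rfl
@[simp] theorem add_re (x y : Oct) : (x + y).re = x.re + y.re := rfl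
@[simp] theorem add_im (x y : Oct) : (x + y).im = x.im + y.im := rfl
@[simp] theorem mul_re (x y : Oct) :
    (x * y).re = x.re * y.re - y.im.adjugate * x.im := rfl
@[simp] theorem mul_im (x y : Oct) :
    (x * y).im = y.im * x.re + x.im * y.re.adjugate := rfl
@[simp] theorem zsmul_re (n : ℤ) (x : Oct) : (n • x).re = n • x.re := rfl
@[simp] theorem zsmul_im (n : ℤ) (x : Oct) : (n • x).im = n • x.im := rfl

theorem toProd_injective : Function.Injective (fun x : Oct => (x.re, x.im)) := by
  intro x y h
  exact Oct.ext (congrArg Prod.fst h) (congrArg Prod.snd h)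

instance : AddCommGroup Oct :=
  Function.Injective.addCommGroup (fun x : Oct => (x.re, x.im)) toProd_injective rfl
    (fun _ _ => rfl) (fun _ => rfl) (fun _ _ => rfl) (fun _ _ => rfl) (fun _ _ => rfl)

theorem quat_conj_add (x y : Quat) : (x + y).adjugate = x.adjugate + y.adjugate :=
  CompositionRing.conj_add x y

theorem quat_conj_apply (x : Quat) :
    x.adjugate 0 0 = x 1 1 ∧ x.adjugate 0 1 = -x 0 1 ∧
      x.adjugate 1 0 = -x 1 0 ∧ x.adjugate 1 1 = x 0 0 := by
  simp [Matrix.adjugate_fin_two]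

instance : NonAssocRing Oct :=
  { (inferInstance : AddCommGroup Oct) with
    left_distrib := by
      intro a b c
      ext1 <;> simp only [add_re, add_im, mul_re, mul_im, quat_conj_add, mul_add, add_mul] <;>
        abel
    right_distrib := by
      intro a b c
      ext1 <;> simp only [add_re, add_im, mul_re, mul_im, mul_add, add_mul] <;>
        abel
    zero_mul := by intro a; ext1 <;> simp
    mul_zero := by intro a; ext1 <;> simp
    one_mul := by intro a; ext1 <;> simp
    mul_one := by intro a; ext1 <;> simp }

instance : CompositionRing Oct where
  conj x := ⟨x.re.adjugate, -x.im⟩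
  nrm x := x.re.det + x.im.det
  tr x := x.re.trace
  conj_add x y := by
    ext1 <;> simp [quat_conj_add, add_comm]
  conj_mul x y := by
    ext1 <;> ext i j <;> fin_cases i <;> fin_cases j <;>
      simp [quat_conj_apply, Matrix.mul_apply, Fin.sum_univ_two] <;> ring
  conj_conj x := by
    ext1
    · exact CompositionRing.conj_conj x.re
    · simp
  mul_conj x := by
    ext1
    · rw [mul_re, zsmul_re, one_re]
      ext i j; fin_cases i <;> fin_cases j <;>
        simp [quat_conj_apply, Matrix.mul_apply, Fin.sum_univ_two, Matrix.det_fin_two,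
          -zsmul_one] <;> ring
    · rw [mul_im, zsmul_im, one_im, smul_zero]
      ext i j; fin_cases i <;> fin_cases j <;>
        simp [quat_conj_apply, Matrix.mul_apply, Fin.sum_univ_two]
  add_conj x := by
    ext1
    · exact CompositionRing.add_conj x.re
    · rw [zsmul_im, one_im, smul_zero]
      exact add_neg_cancel x.im
  nrm_mul x y := by
    simp [quat_conj_apply, Matrix.mul_apply, Fin.sum_univ_two, Matrix.det_fin_two]
    ring

end Oct

/-! ## The cubic lattices `J` -/

/-- The operations of a cubic Jordan algebra on an integral lattice `J`: the cubic form `N`, the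
quadratic adjoint `sharp`, the trace bilinear form `pair`, and the set of diagonal elements.
(Only the instances below are ever used.) -/
class CubicLattice (J : Type) [AddCommGroup J] where
  N : J → ℤ
  sharp : J → J
  pair : J → J → ℤ
  IsDiagonal : J → Prop

/-- The Hermitian `3 × 3` matrix `[a, z, ȳ; z̄, b, x; y, x̄, c]` over `C`. -/
@[ext]
structure Herm3 (C : Type) : Type where
  a : ℤ
  b : ℤ
  c : ℤ
  x : C
  y : C
  z : C

namespace Herm3

theorem toProd_injective {C : Type} :
    Function.Injective (fun A : Herm3 C => (A.a, A.b, A.c, A.x, A.y, A.z)) := by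
  intro A B h
  simp only [Prod.mk.injEq] at h
  obtain ⟨h1, h2, h3, h4, h5, h6⟩ := h
  exact Herm3.ext h1 h2 h3 h4 h5 h6

variable {C : Type} [NonAssocRing C]

instance : Zero (Herm3 C) := ⟨⟨0, 0, 0, 0, 0, 0⟩⟩
instance : Add (Herm3 C) :=
  ⟨fun A B => ⟨A.a + B.a, A.b + B.b, A.c + B.c, A.x + B.x, A.y + B.y, A.z + B.z⟩⟩
instance : Neg (Herm3 C) := ⟨fun A => ⟨-A.a, -A.b, -A.c, -A.x, -A.y, -A.z⟩⟩
instance : Sub (Herm3 C) :=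
  ⟨fun A B => ⟨A.a - B.a, A.b - B.b, A.c - B.c, A.x - B.x, A.y - B.y, A.z - B.z⟩⟩
instance : SMul ℕ (Herm3 C) :=
  ⟨fun n A => ⟨n • A.a, n • A.b, n • A.c, n • A.x, n • A.y, n • A.z⟩⟩
instance : SMul ℤ (Herm3 C) :=
  ⟨fun n A => ⟨n • A.a, n • A.b, n • A.c, n • A.x, n • A.y, n • A.z⟩⟩

instance : AddCommGroup (Herm3 C) :=
  Function.Injective.addCommGroup (fun A : Herm3 C => (A.a, A.b, A.c, A.x, A.y, A.z))
    toProd_injective rfl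
    (fun _ _ => rfl) (fun _ => rfl) (fun _ _ => rfl) (fun _ _ => rfl) (fun _ _ => rfl)

open CompositionRing in
/-- `N(A) = abc - a n(x) - b n(y) - c n(z) + ((xy)z + conj ((xy)z))`; `sharp` is the adjoint
matrix; `pair A B = Tr ((AB + BA) / 2)`. -/
instance [CompositionRing C] : CubicLattice (Herm3 C) where
  N A := A.a * A.b * A.c - A.a * nrm A.x - A.b * nrm A.y - A.c * nrm A.z
    + tr ((A.x * A.y) * A.z)
  sharp A :=
    { a := A.b * A.c - nrm A.x
      b := A.a * A.c - nrm A.y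
      c := A.a * A.b - nrm A.z
      x := conj A.z * conj A.y - A.a • A.x
      y := conj A.x * conj A.z - A.b • A.y
      z := conj A.y * conj A.x - A.c • A.z }
  pair A B := A.a * B.a + A.b * B.b + A.c * B.c
    + tr (A.x * conj B.x) + tr (A.y * conj B.y) + tr (A.z * conj B.z)
  IsDiagonal A := A.x = 0 ∧ A.y = 0 ∧ A.z = 0

end Herm3

/-- The lattice `ℤ ⊕ ℤ ⊕ ℤ` with `N(a, b, c) = abc`; all its elements count as diagonal. -/
abbrev Z3 : Type := ℤ × ℤ × ℤ

instance : CubicLattice Z3 where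
  N A := A.1 * A.2.1 * A.2.2
  sharp A := (A.2.1 * A.2.2, A.1 * A.2.2, A.1 * A.2.1)
  pair A B := A.1 * B.1 + A.2.1 * B.2.1 + A.2.2 * B.2.2
  IsDiagonal _ := True

/-! ## The Freudenthal module and its elementary transformations -/

/-- `M(J) = ℤ ⊕ ℤ ⊕ J ⊕ J`, with elements `(α, β, A, B)`. -/
abbrev FModule (J : Type) : Type := ℤ × ℤ × J × J

namespace FModule

open CubicLattice

variable {J : Type} [AddCommGroup J] [CubicLattice J]

/-- The linearization of the sharp map. -/
def cross (X Y : J) : J := sharp (X + Y) - sharp X - sharp Y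

def phi (C : J) : FModule J → FModule J := fun (α, β, A, B) =>
  (α + pair B C + pair A (sharp C) + β * N C, β, A + β • C, B + cross A C + β • sharp C)

def psi (D : J) : FModule J → FModule J := fun (α, β, A, B) =>
  (α, β + pair A D + pair B (sharp D) + α * N D, A + cross B D + α • sharp D, B + α • D)

def tau : FModule J → FModule J := fun (α, β, A, B) => (-β, α, -B, A)

/-- `s` belongs to the norm-preserving group of `J` (an automorphism of the additive group is the
same as an invertible `ℤ`-linear map). -/
def NormPreserving (s : J ≃+ J) : Prop := ∀ A, N (s A) = N A

/-- `sStar` is the adjoint of `s` with respect to the trace bilinear form (unique, as the form is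
nondegenerate). -/
def IsAdjoint (s sStar : J ≃+ J) : Prop := ∀ X Y, pair (s X) Y = pair X (sStar Y)

/-- The transformation `T(s) : (α, β, A, B) ↦ (α, β, s A, s*⁻¹ B)` for a norm-preserving `s` with
adjoint `sStar = s*`. -/
def T (s sStar : J ≃+ J) : FModule J → FModule J := fun (α, β, A, B) =>
  (α, β, s A, sStar.symm B)

/-- The elementary transformations `φ(C)`, `ψ(D)`, `T(s)`, `τ` with `C, D ∈ J` and `s` in the
norm-preserving group. -/
inductive IsElementary : (FModule J → FModule J) → Prop
  | phi (C : J) : IsElementary (phi C)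
  | psi (D : J) : IsElementary (psi D)
  | T (s sStar : J ≃+ J) (hs : NormPreserving s) (hadj : IsAdjoint s sStar) :
      IsElementary (T s sStar)
  | tau : IsElementary tau

/-- `y` is obtained from `x` by a finite series of elementary transformations. -/
def Reaches (x y : FModule J) : Prop :=
  Relation.ReflTransGen (fun u w => ∃ f, IsElementary f ∧ w = f u) x y

/-- `x = (α, β, A, 0)` with `α > 0`, `α ∣ β`, `α ∣ A` and `A` diagonal. -/
def IsDiagonalReduced (x : FModule J) : Prop :=
  ∃ (α β : ℤ) (A : J), x = (α, β, A, 0) ∧ 0 < α ∧ α ∣ β ∧ (∃ A' : J, A = α • A') ∧ IsDiagonal A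

end FModule

/-! Both halves of the proof are Euclid's algorithm, phrased through a minimal element. In the orbit
of a nonzero element take (α, β, A, B) with α > 0 least. Let C have rank one and (D, C) = 1.
Applying `psi` to a multiple of D shifts (B, C) by a multiple of α and fixes α; `phi C` then adds
(B, C) to the first coordinate. So (B, C) mod α occurs as a first coordinate and must vanish. Such C
detect divisibility, hence α ∣ B (`exists_eq_zsmul_of_minimal`), and one `psi` clears B. When B = 0,
`phi C` puts A × C in the last slot, so α ∣ A × C for all such C, whence α ∣ A. The same move adds
βC to A, which forces α ∣ β. Only the axioms `IsReducible`, valid in all four lattices, are used. It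
remains to diagonalize A by some T(s). For Hermitian matrices take the least nonzero |a| in the
norm-equivalence class. Two opposite transvections replace a by the remainder mod a of the trace
pairing of z with an isotropic w, so a ∣ z (`exists_z_eq_zsmul`). Likewise a divides y; both are
cleared, and the argument is repeated on the remaining 2 × 2 block. Associativity of C is never
needed, only the identities of `SplitComposition`, so octonions are covered. -/

/-! ## Laws of the split composition rings -/

open CompositionRing in
/-- The identities of a composition ring with associative trace form, together with the fact that
the primitive isotropic elements detect divisibility through the trace form. -/
class SplitComposition (C : Type) [NonAssocRing C] [CompositionRing C] : Prop where
  tr_add : ∀ x y : C, tr (x + y) = tr x + tr y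
  tr_conj : ∀ x : C, tr (conj x) = tr x
  nrm_conj : ∀ x : C, nrm (conj x) = nrm x
  nrm_zsmul : ∀ (k : ℤ) (x : C), nrm (k • x) = k ^ 2 * nrm x
  nrm_add : ∀ x y : C, nrm (x + y) = nrm x + nrm y + tr (x * conj y)
  tr_mul_comm : ∀ x y : C, tr (x * y) = tr (y * x)
  tr_mul_assoc : ∀ x y z : C, tr (x * y * z) = tr (x * (y * z))
  mul_conj_mul : ∀ x y : C, x * (conj x * y) = nrm x • y
  exists_eq_zsmul : ∀ (k : ℤ) (z : C),
    (∀ w u : C, nrm w = 0 → tr (u * conj w) = 1 → k ∣ tr (z * conj w)) → ∃ z', z = k • z'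

/-! ### Verification for binarions, quaternions and octonions -/

section

open CompositionRing

instance : SplitComposition Binarion where
  tr_add x y := by simp [tr]; ring
  tr_conj x := by simp [tr, conj]; ring
  nrm_conj x := by simp [nrm, conj]; ring
  nrm_zsmul k x := by simp [nrm]; ring
  nrm_add x y := by simp [nrm, tr, conj]; ring
  tr_mul_comm x y := by simp [tr]; ring
  tr_mul_assoc x y z := by simp [tr]; ring
  mul_conj_mul x y := by ext <;> simp [nrm, conj] <;> ring
  exists_eq_zsmul k z h := by
    have h1 := h (0, 1) (1, 0) (by simp [nrm]) (by simp [tr, conj])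
    have h2 := h (1, 0) (0, 1) (by simp [nrm]) (by simp [tr, conj])
    simp only [tr, conj, Prod.fst_mul, Prod.snd_mul, mul_zero, mul_one, add_zero,
      zero_add] at h1 h2
    obtain ⟨p, hp⟩ := h1
    obtain ⟨q, hq⟩ := h2
    exact ⟨(p, q), by ext <;> simp [hp, hq]⟩

theorem Quat.exists_eq_zsmul (k : ℤ) (z : Quat)
    (h : ∀ w u : Quat, w.det = 0 → (u * w.adjugate).trace = 1 → k ∣ (z * w.adjugate).trace) :
    ∃ z', z = k • z' := by
  -- The four choices of w have the matrix units as adjugates, so the traces read off the entries of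
  -- z.
  have h1 := h !![0, 0; 0, 1] !![1, 0; 0, 0] (by simp) (by simp [Matrix.adjugate_fin_two, Matrix.trace_fin_two])
  have h2 := h !![1, 0; 0, 0] !![0, 0; 0, 1] (by simp) (by simp [Matrix.adjugate_fin_two, Matrix.trace_fin_two])
  have h3 := h !![0, 0; -1, 0] !![0, 1; 0, 0] (by simp) (by simp [Matrix.adjugate_fin_two, Matrix.trace_fin_two])
  have h4 := h !![0, -1; 0, 0] !![0, 0; 1, 0] (by simp) (by simp [Matrix.adjugate_fin_two, Matrix.trace_fin_two])
  simp [Matrix.adjugate_fin_two, Matrix.trace, Matrix.mul_apply, Fin.sum_univ_two]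
    at h1 h2 h3 h4
  obtain ⟨p, hp⟩ := h1
  obtain ⟨q, hq⟩ := h2
  obtain ⟨r, hr⟩ := h3
  obtain ⟨s, hs⟩ := h4
  refine ⟨!![p, r; s, q], ?_⟩
  ext i j; fin_cases i <;> fin_cases j <;> simp [hp, hq, hr, hs]

instance : SplitComposition Quat where
  tr_add x y := Matrix.trace_add x y
  tr_conj x := by
    simp [tr, conj, Oct.quat_conj_apply, Matrix.trace, Fin.sum_univ_two]; ring
  nrm_conj x := by simp [nrm, conj, Matrix.adjugate_fin_two, Matrix.det_fin_two]; ring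
  nrm_zsmul k x := by simp [nrm, Matrix.det_fin_two, -zsmul_eq_mul]
  nrm_add x y := by
    simp [nrm, tr, conj, Oct.quat_conj_apply, Matrix.trace, Fin.sum_univ_two,
      Matrix.mul_apply, Matrix.det_fin_two]
    ring
  tr_mul_comm x y := Matrix.trace_mul_comm x y
  tr_mul_assoc x y z := by rw [mul_assoc]
  mul_conj_mul x y := by
    rw [← mul_assoc, CompositionRing.mul_conj, smul_mul_assoc, one_mul]
  exists_eq_zsmul := Quat.exists_eq_zsmul

instance : SplitComposition Oct where
  tr_add x y := Matrix.trace_add x.re y.re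
  tr_conj x := SplitComposition.tr_conj x.re
  nrm_conj x := by
    simp [nrm, conj, Matrix.adjugate_fin_two, Matrix.det_fin_two]; ring
  nrm_zsmul k x := by simp [nrm, Matrix.det_fin_two, -zsmul_eq_mul]; ring
  nrm_add x y := by
    simp [nrm, tr, conj, Oct.quat_conj_apply, Matrix.trace, Fin.sum_univ_two,
      Matrix.mul_apply, Matrix.det_fin_two]
    ring
  tr_mul_comm x y := by
    simp [tr, Oct.quat_conj_apply, Matrix.trace, Fin.sum_univ_two, Matrix.mul_apply]
    ring
  tr_mul_assoc x y z := by
    simp [tr, Oct.quat_conj_apply, Matrix.trace, Fin.sum_univ_two, Matrix.mul_apply]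
    ring
  mul_conj_mul x y := by
    ext1 <;> ext i j <;> fin_cases i <;> fin_cases j <;>
      simp [conj, nrm, Oct.quat_conj_apply, Matrix.mul_apply, Fin.sum_univ_two,
        Matrix.det_fin_two, -zsmul_eq_mul] <;> ring
  exists_eq_zsmul k z h := by
    obtain ⟨p, hp⟩ := Quat.exists_eq_zsmul k z.re fun w u hw hu => by
      simpa [tr, conj] using h ⟨w, 0⟩ ⟨u, 0⟩ (by simp [nrm, hw]) (by simp [tr, conj, hu])
    obtain ⟨q, hq⟩ := Quat.exists_eq_zsmul k z.im fun w u hw hu => by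
      have e : (-w).adjugate = -w.adjugate := by simp [Matrix.adjugate_fin_two]
      have := h ⟨0, w⟩ ⟨0, u⟩ (by simp [nrm, hw])
        (by simp [tr, conj, e, Matrix.trace_mul_comm w.adjugate, hu])
      simpa [tr, conj, e, Matrix.trace_mul_comm w.adjugate] using this
    exact ⟨⟨p, q⟩, Oct.ext hp hq⟩

namespace CompositionRing

variable {C : Type} [NonAssocRing C] [CompositionRing C]

theorem conj_zsmul (k : ℤ) (x : C) : conj (k • x) = k • conj x :=
  map_zsmul (AddMonoidHom.mk' conj conj_add : C →+ C) k x
theorem conj_neg (x : C) : conj (-x) = -conj x :=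
  map_neg (AddMonoidHom.mk' conj conj_add : C →+ C) x
theorem conj_zero : conj (0 : C) = 0 := map_zero (AddMonoidHom.mk' conj conj_add : C →+ C)

end CompositionRing

namespace SplitComposition

variable {C : Type} [NonAssocRing C] [CompositionRing C] [SplitComposition C]

theorem tr_zero : tr (0 : C) = 0 := by simpa using tr_add (0 : C) 0
theorem tr_zsmul (k : ℤ) (x : C) : tr (k • x) = k * tr x := by
  simpa using map_zsmul (AddMonoidHom.mk' tr tr_add : C →+ ℤ) k x
theorem tr_neg (x : C) : tr (-x) = -tr x := map_neg (AddMonoidHom.mk' tr tr_add : C →+ ℤ) x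
theorem nrm_zero : nrm (0 : C) = 0 := by simpa using nrm_zsmul 0 (0 : C)
theorem tr_mul_conj_self (x : C) : tr (x * conj x) = 2 * nrm x := by
  have h := nrm_add x x
  have h2 := nrm_zsmul 2 x
  rw [two_smul] at h2
  linarith
theorem tr_mul_conj_comm (x y : C) : tr (x * conj y) = tr (y * conj x) := by
  rw [← tr_conj, CompositionRing.conj_mul, conj_conj]
theorem tr_conj_mul_conj (x y : C) : tr (conj x * conj y) = tr (x * y) := by
  rw [← CompositionRing.conj_mul, tr_conj, tr_mul_comm]
theorem tr_conj_mul (x y : C) : tr (conj x * y) = tr (x * conj y) := by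
  rw [← tr_conj_mul_conj, conj_conj]

end SplitComposition

/-! ## Reduction to the form `(α, β, A, 0)` -/

namespace FModule

open CubicLattice

variable {J : Type} [AddCommGroup J] [CubicLattice J]

/-- A rank-one element that pairs to `1` with some element. -/
def IsPrimitiveRankOne (C : J) : Prop :=
  sharp C = 0 ∧ N C = 0 ∧ ∃ D : J, pair D C = 1

/-- The formal properties of a cubic lattice used in the reduction. -/
structure IsReducible (J : Type) [AddCommGroup J] [CubicLattice J] : Prop where
  pair_add_left : ∀ X Y Z : J, pair (X + Y) Z = pair X Z + pair Y Z
  pair_zero_right : ∀ X : J, pair X 0 = 0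
  sharp_zsmul : ∀ (k : ℤ) (X : J), sharp (k • X) = k ^ 2 • sharp X
  exists_eq_zsmul_of_pair : ∀ (k : ℤ) (B : J),
    (∀ C, IsPrimitiveRankOne C → k ∣ pair B C) → ∃ D, B = k • D
  exists_eq_zsmul_of_cross : ∀ (k : ℤ) (A : J),
    (∀ C, IsPrimitiveRankOne C → ∃ D, cross A C = k • D) → ∃ A', A = k • A'
  exists_dvd : ∃ C : J, IsPrimitiveRankOne C ∧
    ∀ (k m : ℤ) (X : J), m • C = k • X → k ∣ m

theorem Reaches.trans {x y z : FModule J} (h : Reaches x y) (h' : Reaches y z) : Reaches x z :=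
  Relation.ReflTransGen.trans h h'

theorem IsElementary.reaches {f : FModule J → FModule J} (hf : IsElementary f) (x : FModule J) :
    Reaches x (f x) :=
  Relation.ReflTransGen.single ⟨f, hf, rfl⟩

/-- τ² = -1. -/
theorem reaches_neg (x : FModule J) : Reaches x (-x) := by
  have h := (IsElementary.tau.reaches x).trans (IsElementary.tau.reaches (tau x))
  exact h

namespace IsReducible

variable (hJ : IsReducible J)
include hJ

theorem pair_zsmul_left (k : ℤ) (X Y : J) : pair (k • X) Y = k * pair X Y := by
  simpa using map_zsmul
    (AddMonoidHom.mk' (fun X => pair X Y) fun X X' => hJ.pair_add_left X X' Y) k X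

theorem pair_zero_left (Y : J) : pair 0 Y = 0 := by simpa using hJ.pair_zsmul_left 0 0 Y

theorem phi_rankOne {C : J} (hC : IsPrimitiveRankOne C) (α β : ℤ) (A B : J) :
    phi C (α, β, A, B) = (α + pair B C, β, A + β • C, B + cross A C) := by
  simp [phi, hC.1, hC.2.1, hJ.pair_zero_right]

theorem exists_reaches_pos {x : FModule J} (hx : x ≠ 0) :
    ∃ y : FModule J, Reaches x y ∧ 0 < y.1 := by
  have of_ne : ∀ {y : FModule J}, Reaches x y → y.1 ≠ 0 → ∃ y, Reaches x y ∧ 0 < y.1 := by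
    intro y hy h
    rcases lt_or_gt_of_ne h with h | h
    · exact ⟨-y, hy.trans (reaches_neg y), by simpa using h⟩
    · exact ⟨y, hy, h⟩
  have of_snd : ∀ {y : FModule J}, Reaches x y → y.2.1 ≠ 0 → ∃ y, Reaches x y ∧ 0 < y.1 :=
    fun {y} hy h => of_ne (hy.trans (IsElementary.tau.reaches y)) (by simpa [tau] using h)
  have of_last : ∀ {y : FModule J}, Reaches x y → y.2.2.2 ≠ 0 →
      ∃ y, Reaches x y ∧ 0 < y.1 := by
    rintro ⟨α, β, A, B⟩ hy h
    by_cases hα : α = 0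
    -- Divisibility by 0 means vanishing, so the detection axiom with k = 0 is nondegeneracy; `phi
    -- C` then moves (B, C) ≠ 0 into the vanishing first coordinate.
    · obtain ⟨C, hC, h0⟩ : ∃ C : J, IsPrimitiveRankOne C ∧ pair B C ≠ 0 := by
        by_contra! hc
        obtain ⟨D, hD⟩ := hJ.exists_eq_zsmul_of_pair 0 B fun C hC => by simp [hc C hC]
        exact h (by simpa using hD)
      refine of_ne (hy.trans ((IsElementary.phi C).reaches _)) ?_
      rw [hJ.phi_rankOne hC]
      simpa [hα] using h0
    · exact of_ne hy hα
  obtain ⟨α, β, A, B⟩ := x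
  by_cases h1 : α = 0
  · by_cases h2 : β = 0
    · by_cases h4 : B = 0
      · refine of_last (IsElementary.tau.reaches _) ?_
        rintro h3
        exact hx (by simpa [h1, h2, h4, tau] using h3)
      · exact of_last .refl h4
    · exact of_snd .refl h2
  · exact of_ne .refl h1

/-- If `α` is the least positive first coordinate in an orbit, it divides the last coordinate of
every element of the orbit with first coordinate `α`. -/
theorem exists_eq_zsmul_of_minimal {x : FModule J} {α : ℤ} (hα : 0 < α)
    (hmin : ∀ y, Reaches x y → 0 < y.1 → α ≤ y.1) {β : ℤ} {A B : J}
    (h : Reaches x (α, β, A, B)) : ∃ D, B = α • D := by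
  refine hJ.exists_eq_zsmul_of_pair α B fun C hC => ?_
  obtain ⟨D, hD⟩ := hC.2.2
  -- The final first coordinate is α + (B, C) + kα; the extra -1 cancels the α already present,
  -- leaving the remainder.
  set k : ℤ := -(pair B C / α) - 1
  have h1 := h.trans ((IsElementary.psi (k • D)).reaches _)
  have h2 := h1.trans ((IsElementary.phi C).reaches _)
  have e : (phi C (psi (k • D) (α, β, A, B))).1 = pair B C % α := by
    rw [psi, hJ.phi_rankOne hC]
    simp only [hJ.pair_add_left, hJ.pair_zsmul_left, hD, Int.emod_def, k]
    ring
  by_contra hdvd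
  have hpos : 0 < pair B C % α :=
    lt_of_le_of_ne (Int.emod_nonneg _ hα.ne') fun h0 => hdvd (Int.dvd_of_emod_eq_zero h0.symm)
  have := hmin _ h2 (e ▸ hpos)
  rw [e] at this
  exact absurd (Int.emod_lt_of_pos (pair B C) hα) (not_lt.mpr this)

/-- This is the change in A when `psi (-D)` clears a last coordinate αD. Every term is a multiple of
D^#, and (α - 1)² - α² - 1 + α = -α. Being divisible by α, it does not affect A mod α. -/
theorem cross_neg (α : ℤ) (D : J) : cross (α • D) (-D) + α • sharp (-D) = α • -sharp D := by
  have e1 : α • D + -D = (α - 1) • D := by rw [sub_smul, one_smul, sub_eq_add_neg]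
  have e2 : sharp (-D) = sharp D := by simpa using hJ.sharp_zsmul (-1) D
  rw [cross, e1, hJ.sharp_zsmul, hJ.sharp_zsmul, e2]
  module

theorem exists_reaches_reduced {x : FModule J} (hx : x ≠ 0) :
    ∃ (α β : ℤ) (A : J), Reaches x (α, β, A, 0) ∧ 0 < α ∧ α ∣ β ∧ ∃ A', A = α • A' := by
  classical
  have hex : ∃ n : ℕ, 0 < n ∧ ∃ y : FModule J, Reaches x y ∧ y.1 = n := by
    obtain ⟨y, hy, h0⟩ := hJ.exists_reaches_pos hx
    exact ⟨y.1.toNat, by omega, y, hy, by omega⟩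
  obtain ⟨hn, ⟨α, β, A, B⟩, hy, hα⟩ := Nat.find_spec hex
  have hpos : 0 < α := by simp only at hα; omega
  have hmin : ∀ y, Reaches x y → 0 < y.1 → α ≤ y.1 := by
    intro y hy h0
    have := Nat.find_min' hex ⟨(by omega : 0 < y.1.toNat), y, hy, by omega⟩
    simp only at hα
    omega
  have clear : ∀ {β : ℤ} {A : J} (D : J), Reaches x (α, β, A, α • D) →
      ∃ β', Reaches x (α, β', A + α • -sharp D, 0) := by
    intro β A D h
    refine ⟨β + pair A (-D) + pair (α • D) (sharp (-D)) + α * N (-D), ?_⟩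
    have h1 := h.trans ((IsElementary.psi (-D)).reaches _)
    rwa [psi, add_assoc A, hJ.cross_neg, smul_neg α D, add_neg_cancel] at h1
  have step : ∀ {β : ℤ} {A C : J}, IsPrimitiveRankOne C → Reaches x (α, β, A, 0) →
      Reaches x (α, β, A + β • C, cross A C) := by
    intro β A C hC h
    have h1 := h.trans ((IsElementary.phi C).reaches _)
    rwa [hJ.phi_rankOne hC, hJ.pair_zero_left, add_zero, zero_add] at h1
  have dvd : ∀ {β : ℤ} {A : J}, Reaches x (α, β, A, 0) → ∃ A', A = α • A' := fun h =>
    hJ.exists_eq_zsmul_of_cross α _ fun C hC =>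
      hJ.exists_eq_zsmul_of_minimal hpos hmin (step hC h)
  obtain ⟨D, rfl⟩ := hJ.exists_eq_zsmul_of_minimal hpos hmin hy
  obtain ⟨β', h⟩ := clear D hy
  refine ⟨α, β', _, h, hpos, ?_, dvd h⟩
  -- Both A and A + βC - αE^# are third coordinates of orbit elements with B = 0, hence divisible by
  -- α. So α ∣ βC, and this particular C lets the divisibility descend to β.
  obtain ⟨C, hC, hCdvd⟩ := hJ.exists_dvd
  have h2 := step hC h
  obtain ⟨E, hE⟩ := hJ.exists_eq_zsmul_of_minimal hpos hmin h2
  rw [hE] at h2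
  obtain ⟨β'', h3⟩ := clear E h2
  obtain ⟨X, hX⟩ := dvd h3
  obtain ⟨Y, hY⟩ := dvd h
  refine hCdvd α β' (X - Y + sharp E) ?_
  rw [hY] at hX
  rw [smul_add, smul_sub, ← hX]
  module

end IsReducible

/-! ### Norm equivalence and passage to a diagonal A -/

/-- `A` can be moved to `A'` by a norm-preserving map having an adjoint. -/
def NormEquivalent (A A' : J) : Prop :=
  ∃ s sStar : J ≃+ J, NormPreserving s ∧ IsAdjoint s sStar ∧ s A = A'

theorem NormEquivalent.refl (A : J) : NormEquivalent A A :=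
  ⟨.refl J, .refl J, fun _ => rfl, fun _ _ => rfl, rfl⟩

theorem NormEquivalent.trans {A B D : J} (h : NormEquivalent A B) (h' : NormEquivalent B D) :
    NormEquivalent A D := by
  obtain ⟨s, s', hs, ha, rfl⟩ := h
  obtain ⟨t, t', ht, hb, rfl⟩ := h'
  exact ⟨s.trans t, t'.trans s', fun X => (ht _).trans (hs X),
    fun X Y => (hb _ _).trans (ha _ _), rfl⟩

/-- T(s) fixes α, β and B = 0, and additivity of s preserves divisibility of A by α. -/
theorem IsReducible.exists_isDiagonalReduced (hJ : IsReducible J)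
    (hdiag : ∀ A : J, ∃ A', NormEquivalent A A' ∧ IsDiagonal A') {x : FModule J} (hx : x ≠ 0) :
    ∃ y, Reaches x y ∧ IsDiagonalReduced y := by
  obtain ⟨α, β, A, h, hα, hβ, A', hA'⟩ := hJ.exists_reaches_reduced hx
  obtain ⟨_, ⟨s, t, hs, hst, rfl⟩, hd⟩ := hdiag A
  have h1 := h.trans ((IsElementary.T s t hs hst).reaches _)
  refine ⟨_, h1, α, β, s A, by simp [T], hα, hβ, ⟨s A', ?_⟩, hd⟩
  rw [hA', map_zsmul]

end FModule

/-! ### The lattice of integer triples -/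

theorem Z3.isReducible : FModule.IsReducible Z3 := by
  have h1 : FModule.IsPrimitiveRankOne ((1, 0, 0) : Z3) :=
    ⟨rfl, rfl, (1, 0, 0), rfl⟩
  have h2 : FModule.IsPrimitiveRankOne ((0, 1, 0) : Z3) :=
    ⟨rfl, rfl, (0, 1, 0), rfl⟩
  have h3 : FModule.IsPrimitiveRankOne ((0, 0, 1) : Z3) :=
    ⟨rfl, rfl, (0, 0, 1), rfl⟩
  refine ⟨?_, ?_, ?_, ?_, ?_, ⟨(1, 0, 0), h1, ?_⟩⟩
  · intro X Y Z; simp [CubicLattice.pair]; ring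
  · intro X; simp [CubicLattice.pair]
  · intro k X; ext <;> simp [CubicLattice.sharp] <;> ring
  · intro k B h
    obtain ⟨p, hp⟩ := h _ h1
    obtain ⟨q, hq⟩ := h _ h2
    obtain ⟨r, hr⟩ := h _ h3
    simp [CubicLattice.pair] at hp hq hr
    exact ⟨(p, q, r), by ext <;> simp [hp, hq, hr]⟩
  · intro k A h
    obtain ⟨⟨p, p', p''⟩, hp⟩ := h _ h1
    obtain ⟨⟨q, q', q''⟩, hq⟩ := h _ h2
    simp [FModule.cross, CubicLattice.sharp, Prod.ext_iff] at hp hq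
    -- For A = (a, b, c), A × e₁ = (0, c, b) and A × e₂ = (c, 0, a).
    refine ⟨(q'', p'', p'), ?_⟩
    ext <;> simp <;> linarith
  · intro k m X h
    exact ⟨X.1, by simpa using congrArg Prod.fst h⟩

/-! ## Diagonalization of Hermitian matrices -/

namespace Herm3

open SplitComposition CubicLattice FModule

theorem exists_minimal {C : Type} {P : Herm3 C → Prop} (h : ∃ A, P A ∧ A.a ≠ 0) :
    ∃ A, P A ∧ A.a ≠ 0 ∧ ∀ B, P B → B.a ≠ 0 → A.a.natAbs ≤ B.a.natAbs := by
  classical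
  have hex : ∃ n : ℕ, ∃ A, P A ∧ A.a ≠ 0 ∧ A.a.natAbs = n := by
    obtain ⟨A, hA, h0⟩ := h
    exact ⟨_, A, hA, h0, rfl⟩
  obtain ⟨A, hA, h0, hn⟩ := Nat.find_spec hex
  exact ⟨A, hA, h0, fun B hB hB0 => hn ▸ Nat.find_min' hex ⟨B, hB, hB0, rfl⟩⟩

section Fields

variable {C : Type} [NonAssocRing C] (A B : Herm3 C) (k : ℤ)

@[simp] theorem add_a : (A + B).a = A.a + B.a := rfl
@[simp] theorem add_b : (A + B).b = A.b + B.b := rfl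
@[simp] theorem add_c : (A + B).c = A.c + B.c := rfl
@[simp] theorem add_x : (A + B).x = A.x + B.x := rfl
@[simp] theorem add_y : (A + B).y = A.y + B.y := rfl
@[simp] theorem add_z : (A + B).z = A.z + B.z := rfl
@[simp] theorem sub_a : (A - B).a = A.a - B.a := rfl
@[simp] theorem sub_b : (A - B).b = A.b - B.b := rfl
@[simp] theorem sub_c : (A - B).c = A.c - B.c := rfl
@[simp] theorem sub_x : (A - B).x = A.x - B.x := rfl
@[simp] theorem sub_y : (A - B).y = A.y - B.y := rfl
@[simp] theorem sub_z : (A - B).z = A.z - B.z := rfl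
@[simp] theorem zero_a : (0 : Herm3 C).a = 0 := rfl
@[simp] theorem zero_b : (0 : Herm3 C).b = 0 := rfl
@[simp] theorem zero_c : (0 : Herm3 C).c = 0 := rfl
@[simp] theorem zero_x : (0 : Herm3 C).x = 0 := rfl
@[simp] theorem zero_y : (0 : Herm3 C).y = 0 := rfl
@[simp] theorem zero_z : (0 : Herm3 C).z = 0 := rfl
@[simp] theorem zsmul_a : (k • A).a = k * A.a := rfl
@[simp] theorem zsmul_b : (k • A).b = k * A.b := rfl
@[simp] theorem zsmul_c : (k • A).c = k * A.c := rfl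
@[simp] theorem zsmul_x : (k • A).x = k • A.x := rfl
@[simp] theorem zsmul_y : (k • A).y = k • A.y := rfl
@[simp] theorem zsmul_z : (k • A).z = k • A.z := rfl

end Fields

variable {C : Type} [NonAssocRing C]

/-- Cyclic permutation of the rows and columns. -/
def cycleEquiv : Herm3 C ≃+ Herm3 C where
  toFun A := ⟨A.b, A.c, A.a, A.y, A.z, A.x⟩
  invFun A := ⟨A.c, A.a, A.b, A.z, A.x, A.y⟩
  left_inv _ := rfl
  right_inv _ := rfl
  map_add' _ _ := rfl

theorem cycleEquiv_apply (A : Herm3 C) : cycleEquiv A = ⟨A.b, A.c, A.a, A.y, A.z, A.x⟩ := rfl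
theorem cycleEquiv_symm_apply (A : Herm3 C) :
    cycleEquiv.symm A = ⟨A.c, A.a, A.b, A.z, A.x, A.y⟩ := rfl
variable [CompositionRing C]

/-- Exchange of the first two rows and columns. -/
def swapEquiv : Herm3 C ≃+ Herm3 C where
  toFun A := ⟨A.b, A.a, A.c, conj A.y, conj A.x, conj A.z⟩
  invFun A := ⟨A.b, A.a, A.c, conj A.y, conj A.x, conj A.z⟩
  left_inv A := by simp [conj_conj]
  right_inv A := by simp [conj_conj]
  map_add' A B := by ext <;> simp [conj_add]

theorem swapEquiv_apply (A : Herm3 C) :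
    swapEquiv A = ⟨A.b, A.a, A.c, conj A.y, conj A.x, conj A.z⟩ := rfl

theorem N_def (A : Herm3 C) : N A = A.a * A.b * A.c - A.a * nrm A.x - A.b * nrm A.y
    - A.c * nrm A.z + tr ((A.x * A.y) * A.z) := rfl

theorem pair_def (A B : Herm3 C) : pair A B = A.a * B.a + A.b * B.b + A.c * B.c
    + tr (A.x * conj B.x) + tr (A.y * conj B.y) + tr (A.z * conj B.z) := rfl

theorem sharp_def (A : Herm3 C) : sharp A =
    { a := A.b * A.c - nrm A.x
      b := A.a * A.c - nrm A.y
      c := A.a * A.b - nrm A.z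
      x := conj A.z * conj A.y - A.a • A.x
      y := conj A.x * conj A.z - A.b • A.y
      z := conj A.y * conj A.x - A.c • A.z } := rfl

theorem isAdjoint_cycleEquiv : IsAdjoint (cycleEquiv : Herm3 C ≃+ Herm3 C) cycleEquiv.symm := by
  intro A B
  simp only [pair_def, cycleEquiv_apply, cycleEquiv_symm_apply]
  ring

variable [SplitComposition C]

/-! ### Rank-one Hermitian matrices and divisibility -/

theorem isPrimitiveRankOne_a : IsPrimitiveRankOne (⟨1, 0, 0, 0, 0, 0⟩ : Herm3 C) :=
  ⟨by ext <;> simp [sharp_def, nrm_zero, conj_zero], by simp [N_def, nrm_zero, tr_zero],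
    ⟨1, 0, 0, 0, 0, 0⟩, by simp [pair_def, tr_zero]⟩
theorem isPrimitiveRankOne_b : IsPrimitiveRankOne (⟨0, 1, 0, 0, 0, 0⟩ : Herm3 C) :=
  ⟨by ext <;> simp [sharp_def, nrm_zero, conj_zero], by simp [N_def, nrm_zero, tr_zero],
    ⟨0, 1, 0, 0, 0, 0⟩, by simp [pair_def, tr_zero]⟩
theorem isPrimitiveRankOne_c : IsPrimitiveRankOne (⟨0, 0, 1, 0, 0, 0⟩ : Herm3 C) :=
  ⟨by ext <;> simp [sharp_def, nrm_zero, conj_zero], by simp [N_def, nrm_zero, tr_zero],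
    ⟨0, 0, 1, 0, 0, 0⟩, by simp [pair_def, tr_zero]⟩
theorem isPrimitiveRankOne_x {w u : C} (hw : nrm w = 0) (hu : tr (u * conj w) = 1) :
    IsPrimitiveRankOne (⟨0, 0, 0, w, 0, 0⟩ : Herm3 C) :=
  ⟨by ext <;> simp [sharp_def, nrm_zero, conj_zero, hw], by simp [N_def, nrm_zero, tr_zero],
    ⟨0, 0, 0, u, 0, 0⟩, by simp [pair_def, tr_zero, hu]⟩
theorem isPrimitiveRankOne_y {w u : C} (hw : nrm w = 0) (hu : tr (u * conj w) = 1) :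
    IsPrimitiveRankOne (⟨0, 0, 0, 0, w, 0⟩ : Herm3 C) :=
  ⟨by ext <;> simp [sharp_def, nrm_zero, conj_zero, hw], by simp [N_def, nrm_zero, tr_zero],
    ⟨0, 0, 0, 0, u, 0⟩, by simp [pair_def, tr_zero, hu]⟩
theorem isPrimitiveRankOne_z {w u : C} (hw : nrm w = 0) (hu : tr (u * conj w) = 1) :
    IsPrimitiveRankOne (⟨0, 0, 0, 0, 0, w⟩ : Herm3 C) :=
  ⟨by ext <;> simp [sharp_def, nrm_zero, conj_zero, hw], by simp [N_def, nrm_zero, tr_zero],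
    ⟨0, 0, 0, 0, 0, u⟩, by simp [pair_def, tr_zero, hu]⟩

theorem isReducible : IsReducible (Herm3 C) where
  pair_add_left X Y Z := by simp [pair_def, add_mul, tr_add]; ring
  pair_zero_right X := by simp [pair_def, conj_zero, tr_zero]
  sharp_zsmul k X := by
    ext <;> simp [sharp_def, nrm_zsmul, conj_zsmul, smul_smul, smul_sub, -zsmul_eq_mul,
      smul_mul_assoc, mul_smul_comm] <;> first | ring1 | module
  exists_eq_zsmul_of_pair k B h := by
    obtain ⟨a, ha⟩ := h _ isPrimitiveRankOne_a
    obtain ⟨b, hb⟩ := h _ isPrimitiveRankOne_b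
    obtain ⟨c, hc⟩ := h _ isPrimitiveRankOne_c
    obtain ⟨x, hx⟩ := exists_eq_zsmul k B.x fun w u hw hu => by
      simpa [pair_def, conj_zero, tr_zero] using h _ (isPrimitiveRankOne_x hw hu)
    obtain ⟨y, hy⟩ := exists_eq_zsmul k B.y fun w u hw hu => by
      simpa [pair_def, conj_zero, tr_zero] using h _ (isPrimitiveRankOne_y hw hu)
    obtain ⟨z, hz⟩ := exists_eq_zsmul k B.z fun w u hw hu => by
      simpa [pair_def, conj_zero, tr_zero] using h _ (isPrimitiveRankOne_z hw hu)
    simp only [pair_def, conj_zero, tr_zero, mul_zero, mul_one, add_zero, zero_add] at ha hb hc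
    exact ⟨⟨a, b, c, x, y, z⟩, Herm3.ext ha hb hc hx hy hz⟩
  exists_eq_zsmul_of_cross k A h := by
    -- Crossing with the first diagonal unit gives diagonal (0, c, b) and -x in place of x; the
    -- other two units give the remaining entries.
    obtain ⟨P, hP⟩ := h _ isPrimitiveRankOne_a
    obtain ⟨Q, hQ⟩ := h _ isPrimitiveRankOne_b
    obtain ⟨R, hR⟩ := h _ isPrimitiveRankOne_c
    rw [cross, isPrimitiveRankOne_a.1, sub_zero] at hP
    rw [cross, isPrimitiveRankOne_b.1, sub_zero] at hQ
    rw [cross, isPrimitiveRankOne_c.1, sub_zero] at hR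
    have hc := congrArg Herm3.b hP
    have hb := congrArg Herm3.c hP
    have ha := congrArg Herm3.c hQ
    have hx := congrArg Herm3.x hP
    have hy := congrArg Herm3.y hQ
    have hz := congrArg Herm3.z hR
    simp [sharp_def, -zsmul_eq_mul, add_smul] at ha hb hc hx hy hz
    refine ⟨⟨Q.c, P.c, P.b, -P.x, -Q.y, -R.z⟩, Herm3.ext ?_ ?_ ?_ ?_ ?_ ?_⟩ <;>
      simp only [zsmul_a, zsmul_b, zsmul_c, zsmul_x, zsmul_y, zsmul_z, smul_neg]
    · linarith
    · linarith
    · linarith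
    · rw [← hx, neg_neg]
    · rw [← hy, neg_neg]
    · rw [← hz, neg_neg]
  exists_dvd := by
    refine ⟨_, isPrimitiveRankOne_a, fun k m X h => ⟨X.a, ?_⟩⟩
    simpa using congrArg Herm3.a h

/-! ### Transvections and permutations as norm-preserving maps -/

/-- Addition of `w` times the second row to the first one, and the conjugate column operation. -/
def transvection (w : C) : Herm3 C ≃+ Herm3 C where
  toFun A := ⟨A.a + tr (w * conj A.z) + nrm w * A.b, A.b, A.c, A.x, A.y + conj A.x * conj w,
    A.z + A.b • w⟩
  invFun A := ⟨A.a - tr (w * conj A.z) + nrm w * A.b, A.b, A.c, A.x, A.y - conj A.x * conj w,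
    A.z - A.b • w⟩
  left_inv A := by
    ext <;> simp only [add_sub_cancel_right, conj_add, mul_add, tr_add, conj_zsmul,
      mul_smul_comm, tr_zsmul, tr_mul_conj_self]
    ring
  right_inv A := by
    ext <;> simp only [sub_eq_add_neg, conj_add, mul_add, tr_add, conj_zsmul,
      conj_neg, mul_neg, tr_neg, mul_smul_comm, tr_zsmul, tr_mul_conj_self, neg_add_cancel_right]
    ring
  map_add' A B := by
    ext <;> simp only [add_a, add_b, add_c, add_x, add_y, add_z, conj_add, mul_add, add_mul,
      tr_add, add_smul]
    · ring
    · abel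
    · abel

theorem transvection_apply (w : C) (A : Herm3 C) : transvection w A =
    ⟨A.a + tr (w * conj A.z) + nrm w * A.b, A.b, A.c, A.x, A.y + conj A.x * conj w,
      A.z + A.b • w⟩ := rfl

/-- Addition of `conj w` times the first row to the second one, and the conjugate column
operation. -/
def transvection' (w : C) : Herm3 C ≃+ Herm3 C :=
  (swapEquiv.trans (transvection (conj w))).trans swapEquiv

theorem transvection'_apply (w : C) (A : Herm3 C) : transvection' w A =
    ⟨A.a, A.b + tr (w * conj A.z) + nrm w * A.a, A.c, A.x + conj w * conj A.y, A.y,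
      A.z + A.a • w⟩ := by
  simp only [transvection', AddEquiv.trans_apply, swapEquiv_apply, transvection_apply,
    conj_add, conj_conj, CompositionRing.conj_mul, conj_zsmul, nrm_conj, tr_conj_mul]

theorem normPreserving_swapEquiv : NormPreserving (swapEquiv : Herm3 C ≃+ Herm3 C) := by
  intro A
  simp only [N_def, swapEquiv_apply, nrm_conj, ← CompositionRing.conj_mul, tr_conj]
  rw [tr_mul_comm]
  ring

theorem isAdjoint_swapEquiv : IsAdjoint (swapEquiv : Herm3 C ≃+ Herm3 C) swapEquiv := by
  intro A B
  simp only [pair_def, swapEquiv_apply, tr_conj_mul, conj_conj]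
  ring

theorem normPreserving_cycleEquiv : NormPreserving (cycleEquiv : Herm3 C ≃+ Herm3 C) := by
  intro A
  simp only [N_def, cycleEquiv_apply]
  rw [tr_mul_comm, ← tr_mul_assoc]
  ring

/-- For associative C this is congruence by a unipotent matrix. In general the terms in w cancel
after expanding the norms, by x(x̄y) = n(x)y and associativity under the trace. -/
theorem normPreserving_transvection (w : C) : NormPreserving (transvection w) := by
  intro A
  have e2 : nrm (A.y + conj A.x * conj w) = nrm A.y + nrm A.x * nrm w + tr (A.x * A.y * w) := by
    rw [nrm_add, nrm_mul, nrm_conj, nrm_conj, CompositionRing.conj_mul, conj_conj, conj_conj,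
      ← tr_mul_assoc, tr_mul_comm, ← tr_mul_assoc]
  have e3 : nrm (A.z + A.b • w) = nrm A.z + A.b ^ 2 * nrm w + A.b * tr (w * conj A.z) := by
    rw [nrm_add, nrm_zsmul, conj_zsmul, mul_smul_comm, tr_zsmul, tr_mul_conj_comm]
  simp only [N_def, transvection_apply, e2, e3, mul_add, add_mul, tr_add, mul_conj_mul,
    mul_smul_comm, smul_mul_assoc, tr_zsmul, tr_conj_mul, tr_mul_conj_self]
  ring

theorem isAdjoint_transvection (w : C) : IsAdjoint (transvection w) (transvection' w) := by
  intro A B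
  have e : tr (conj A.x * conj w * conj B.y) = tr (A.x * conj (conj w * conj B.y)) := by
    rw [tr_mul_assoc, tr_conj_mul]
  simp only [pair_def, transvection_apply, transvection'_apply, add_mul, conj_add, mul_add,
    tr_add, e, smul_mul_assoc, conj_zsmul, mul_smul_comm, tr_zsmul, tr_mul_conj_comm w A.z]
  ring

theorem normEquivalent_swapEquiv (A : Herm3 C) : NormEquivalent A (swapEquiv A) :=
  ⟨_, _, normPreserving_swapEquiv, isAdjoint_swapEquiv, rfl⟩

theorem normEquivalent_cycleEquiv (A : Herm3 C) : NormEquivalent A (cycleEquiv A) :=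
  ⟨_, _, normPreserving_cycleEquiv, isAdjoint_cycleEquiv, rfl⟩

theorem normEquivalent_transvection (w : C) (A : Herm3 C) :
    NormEquivalent A (transvection w A) :=
  ⟨_, _, normPreserving_transvection w, isAdjoint_transvection w, rfl⟩

theorem normEquivalent_transvection' (w : C) (A : Herm3 C) :
    NormEquivalent A (transvection' w A) :=
  ((normEquivalent_swapEquiv A).trans (normEquivalent_transvection _ _)).trans
    (normEquivalent_swapEquiv _)

/-- Exchange of the last two rows and columns. -/
theorem normEquivalent_swap_bc (A : Herm3 C) :
    NormEquivalent A ⟨A.a, A.c, A.b, conj A.x, conj A.z, conj A.y⟩ :=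
  ((normEquivalent_cycleEquiv A).trans (normEquivalent_cycleEquiv _)).trans
    (normEquivalent_swapEquiv _)

/-! ### Euclidean reduction of the off-diagonal entries -/

/-- A family of Hermitian matrices that is stable under transvections in the upper left block. -/
structure TransvectionStable (P : Herm3 C → Prop) : Prop where
  transvection : ∀ (w : C) {A : Herm3 C}, P A → P (transvection w A)
  transvection' : ∀ (w : C) {A : Herm3 C}, P A → P (transvection' w A)

/-- When a = b = 0 a transvection by w changes a to the trace pairing of w and z, which must
therefore vanish for every w. -/
theorem z_eq_zero_of_a_eq_zero {P : Herm3 C → Prop} (hP : TransvectionStable P)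
    (h0 : ∀ A, P A → A.a = 0) {A : Herm3 C} (hA : P A) (hb : A.b = 0) : A.z = 0 := by
  obtain ⟨z, hz⟩ := exists_eq_zsmul 0 A.z fun w u _ _ => by
    have h := h0 _ (hP.transvection w hA)
    rw [transvection_apply] at h
    simp only [h0 A hA, hb, mul_zero, add_zero, zero_add] at h
    rw [tr_mul_conj_comm, h]
  rw [hz, zero_smul]

/-- A nonzero upper left entry of least absolute value divides the entry `z`. -/
theorem exists_z_eq_zsmul {P : Herm3 C → Prop} (hP : TransvectionStable P) {A : Herm3 C}
    (hA : P A) (ha : A.a ≠ 0) (hmin : ∀ B, P B → B.a ≠ 0 → A.a.natAbs ≤ B.a.natAbs) :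
    ∃ z, A.z = A.a • z := by
  refine exists_eq_zsmul _ _ fun w u hw hu => ?_
  set m := tr (A.z * conj w)
  -- The first map adds a multiple of au to z; since n(w) = 0, the second does not see b and only
  -- adds the pairing of w with the new z to a.
  have h := hP.transvection w (hP.transvection' ((-(m / A.a) - 1) • u) hA)
  have e : (transvection w (transvection' ((-(m / A.a) - 1) • u) A)).a = m % A.a := by
    simp only [transvection_apply, transvection'_apply, hw, zero_mul, add_zero]
    rw [tr_mul_conj_comm, add_mul, tr_add, smul_mul_assoc, smul_mul_assoc, tr_zsmul, tr_zsmul,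
      hu, Int.emod_def]
    ring
  by_contra hdvd
  have hne : m % A.a ≠ 0 := fun h0 => hdvd (Int.dvd_of_emod_eq_zero h0)
  have hle := hmin _ h (e ▸ hne)
  rw [e] at hle
  have h1 := Int.emod_nonneg m ha
  have h2 := Int.emod_lt_abs m ha
  rw [Int.abs_eq_natAbs] at h2
  omega

theorem transvectionStable_normEquivalent (A : Herm3 C) :
    TransvectionStable (NormEquivalent A) where
  transvection w _ h := h.trans (normEquivalent_transvection w _)
  transvection' w _ h := h.trans (normEquivalent_transvection' w _)

theorem exists_normEquivalent_y_z_eq_zero (A : Herm3 C) :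
    ∃ A', NormEquivalent A A' ∧ A'.y = 0 ∧ A'.z = 0 := by
  have hP := transvectionStable_normEquivalent A
  by_cases h : ∃ B, NormEquivalent A B ∧ B.a ≠ 0
  · obtain ⟨B, hB, hB0, hmin⟩ := exists_minimal h
    obtain ⟨z, hz⟩ := exists_z_eq_zsmul hP hB hB0 hmin
    -- Exchanging the last two indices keeps a, so the same minimal B serves with the conjugate of y
    -- in place of z. Clearing z then alters neither a nor y.
    obtain ⟨y, hy⟩ := exists_z_eq_zsmul hP (hB.trans (normEquivalent_swap_bc B)) hB0 hmin
    have h2 := (hP.transvection' (-z) hB).trans (normEquivalent_swap_bc _)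
    refine ⟨_, hP.transvection' (-y) h2, ?_, ?_⟩
    · simp [transvection'_apply, hz, conj_zero, -zsmul_eq_mul]
    · simp only at hy
      simp [transvection'_apply, hy, -zsmul_eq_mul]
  · push Not at h
    -- If a vanishes on the whole class, so does b by the swap; cycling carries y to the place of z.
    have hz : ∀ B, NormEquivalent A B → B.z = 0 := fun B hB =>
      z_eq_zero_of_a_eq_zero hP h hB (h _ (hB.trans (normEquivalent_swapEquiv B)))
    have hy : A.y = 0 :=
      hz _ ((normEquivalent_cycleEquiv A).trans (normEquivalent_cycleEquiv _))
    exact ⟨A, .refl A, hy, hz A (.refl A)⟩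

/-- The minimum is taken only over equivalent matrices with x = y = 0, a condition that
transvections preserve, so clearing z brings back no other entry. -/
theorem exists_normEquivalent_isDiagonal_of_block {A : Herm3 C} (hx : A.x = 0) (hy : A.y = 0) :
    ∃ A', NormEquivalent A A' ∧ IsDiagonal A' := by
  have hP : TransvectionStable fun B => NormEquivalent A B ∧ B.x = 0 ∧ B.y = 0 :=
    { transvection := fun w B hB => ⟨hB.1.trans (normEquivalent_transvection w B), by
        simp [transvection_apply, hB.2.1, hB.2.2, conj_zero]⟩
      transvection' := fun w B hB => ⟨hB.1.trans (normEquivalent_transvection' w B), by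
        simp [transvection'_apply, hB.2.1, hB.2.2, conj_zero]⟩ }
  by_cases h : ∃ B, (NormEquivalent A B ∧ B.x = 0 ∧ B.y = 0) ∧ B.a ≠ 0
  · obtain ⟨B, hB, hB0, hmin⟩ := exists_minimal h
    obtain ⟨z, hz⟩ := exists_z_eq_zsmul hP hB hB0 hmin
    have h2 := hP.transvection' (-z) hB
    exact ⟨_, h2.1, h2.2.1, h2.2.2, by simp [transvection'_apply, hz, -zsmul_eq_mul]⟩
  · push Not at h
    have hb : A.b = 0 := h (swapEquiv A) ⟨normEquivalent_swapEquiv A, by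
      simp [swapEquiv_apply, hx, hy, conj_zero]⟩
    exact ⟨A, .refl A, hx, hy, z_eq_zero_of_a_eq_zero hP h ⟨.refl A, hx, hy⟩ hb⟩

theorem exists_normEquivalent_isDiagonal (A : Herm3 C) :
    ∃ A', NormEquivalent A A' ∧ IsDiagonal A' := by
  obtain ⟨B, hB, hy, hz⟩ := exists_normEquivalent_y_z_eq_zero A
  obtain ⟨D, hD, hd⟩ := exists_normEquivalent_isDiagonal_of_block (A := cycleEquiv B) hy hz
  exact ⟨D, (hB.trans (normEquivalent_cycleEquiv B)).trans hD, hd⟩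

theorem exists_isDiagonalReduced (x : FModule (Herm3 C)) (hx : x ≠ 0) :
    ∃ y, FModule.Reaches x y ∧ FModule.IsDiagonalReduced y :=
  isReducible.exists_isDiagonalReduced exists_normEquivalent_isDiagonal hx

end Herm3

end

theorem lemma4 :
    (∀ x : FModule (Herm3 Binarion), x ≠ 0 →
      ∃ y, FModule.Reaches x y ∧ FModule.IsDiagonalReduced y) ∧
    (∀ x : FModule (Herm3 Quat), x ≠ 0 →
      ∃ y, FModule.Reaches x y ∧ FModule.IsDiagonalReduced y) ∧
    (∀ x : FModule (Herm3 Oct), x ≠ 0 →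
      ∃ y, FModule.Reaches x y ∧ FModule.IsDiagonalReduced y) ∧
    (∀ x : FModule Z3, x ≠ 0 →
      ∃ y, FModule.Reaches x y ∧ FModule.IsDiagonalReduced y) :=
  ⟨Herm3.exists_isDiagonalReduced, Herm3.exists_isDiagonalReduced,
    Herm3.exists_isDiagonalReduced, fun _ hx => Z3.isReducible.exists_isDiagonalReduced
      (fun A => ⟨A, .refl A, trivial⟩) hx⟩
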